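/- In the unordered CNF game there is a CNF $\varphi$ (a finite conjunction of clauses, each a finite disjunction of literals) and a finite set of variables $X$ containing all variables that appear in $\varphi$ and possibly more. Two players, T and F, alternate turns; each turn consists of picking an unassigned variable from $X$ and picking a value $0$ or $1$ to assign to it. The game ends when all variables are assigned; T wins if $\varphi$ is satisfied (every clause has a true literal), and F wins otherwise (some clause has all its literals false). The first and the last move belong to the same player exactly when $|X|$ is odd. A CNF is $k$-uniform if every clause has exactly $k$ literals, corresponding to $k$ distinct variables. For $k\ge 0$ and $a,b\in\{\mathrm T,\mathrm F\}$, let $M_{k,a\cdots b}$ be the minimum number of clauses in $\varphi$ over all game instances $(\varphi,X)$ such that $\varphi$ is $k$-uniform and F has a winning strategy when player $a$ has the first move and player $b$ has the last move. Let $\mathrm{Fib}_n$ denote the Fibonacci numbers, $\mathrm{Fib}_1=\mathrm{Fib}_2=1$, $\mathrm{Fib}_{n+2}=\mathrm{Fib}_{n+1}+\mathrm{Fib}_n$. Then the following hold. 1. For every odd $k\ge 1$, $M_{k,\mathrm F\cdots \mathrm F}=\sqrt2^{\,k-1}$; and for every even $k\ge 0$, $1.5\cdot\sqrt2^{\,k-2}\le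 M_{k,\mathrm F\cdots \mathrm F}\le \sqrt2^{\,k}$. 2. For every $k\ge 0$, $1.5^{\,k-1}\le M_{k,\mathrm F\cdots \mathrm T}\le \mathrm{Fib}_{k+1}$. -/

import Mathlib

namespace CNFGame

/-- The two players: `T` wants the CNF to be satisfied, `F` wants it to be unsatisfied. -/
inductive Player : Type
  | T : Player
  | F : Player

/-- The opponent of a player. -/
def Player.other : Player → Player
  | .T => .F
  | .F => .T

/-- A literal: `(x, true)` is the positive literal of the variable `x`, and `(x, false)` is the
negative one. Variables are named by natural numbers (a countably infinite supply, which is enough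
since every game instance is finite). -/
abbrev Literal : Type := ℕ × Bool

/-- A clause is a finite set (disjunction) of literals. -/
abbrev Clause : Type := Finset Literal

/-- A CNF is a finite set (conjunction) of clauses. -/
abbrev CNF : Type := Finset Clause

/-- Every clause has exactly `k` literals, which correspond to `k` distinct variables. -/
def IsUniform (k : ℕ) (φ : CNF) : Prop :=
  ∀ C ∈ φ, C.card = k ∧ (C.image Prod.fst).card = k

/-- `(φ, X)` is an instance of the unordered CNF game: `X` is a finite set of variables that
contains all variables that appear in `φ`, and possibly more. -/
def IsInstance (φ : CNF) (X : Finset ℕ) : Prop :=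
  ∀ C ∈ φ, ∀ l ∈ C, l.1 ∈ X

/-- A move `(x, b)` assigns the bit `b` to the variable `x`. -/
abbrev Move : Type := ℕ × Bool

/-- The list of the moves made so far, the most recent one first. -/
abbrev History : Type := List Move

/-- The variables of `X` that are not assigned yet. -/
def unassigned (X : Finset ℕ) (h : History) : Finset ℕ :=
  X.filter fun x => ∀ b : Bool, (x, b) ∉ h

/-- The player whose turn it is after `n` moves, when `a` has the first move. -/
def turn (a : Player) (n : ℕ) : Player :=
  if Even n then a else a.other

/-- A strategy chooses a move, depending on all the moves made so far. -/
abbrev Strategy : Type := History → Move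

/-- The (partial) plays of the game on `X` in which `a` moves first, the player `T` makes arbitrary
legal moves, and the player `F` makes the moves chosen by `σ`. -/
inductive PlayedWith (X : Finset ℕ) (a : Player) (σ : Strategy) : History → Prop
  | start : PlayedWith X a σ []
  | moveT (h : History) (m : Move) : PlayedWith X a σ h → turn a h.length = Player.T →
      m.1 ∈ unassigned X h → PlayedWith X a σ (m :: h)
  | moveF (h : History) : PlayedWith X a σ h → turn a h.length = Player.F →
      (unassigned X h).Nonempty → PlayedWith X a σ (σ h :: h)

/-- Some clause of `φ` has all its literals false under the assignments made in `h`. -/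
def Unsatisfied (φ : CNF) (h : History) : Prop :=
  ∃ C ∈ φ, ∀ l ∈ C, (l.1, !l.2) ∈ h

/-- `σ` is a winning strategy for `F` in `(φ, X)` when `a` moves first: it only makes legal moves
(it picks an unassigned variable of `X` whenever it is `F`'s turn and the game is not over), and at
the end of every play that follows it `φ` is unsatisfied. -/
def IsWinningStrategy (φ : CNF) (X : Finset ℕ) (a : Player) (σ : Strategy) : Prop :=
  ∀ h : History, PlayedWith X a σ h →
    (turn a h.length = Player.F → (unassigned X h).Nonempty → (σ h).1 ∈ unassigned X h) ∧
    (unassigned X h = ∅ → Unsatisfied φ h)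

/-- `F` has a winning strategy in `(φ, X)` when `a` moves first. -/
def FWins (φ : CNF) (X : Finset ℕ) (a : Player) : Prop :=
  ∃ σ : Strategy, IsWinningStrategy φ X a σ

/-- In the game on `X` with `a` moving first, the player `b` has the last move: the first and the
last mover are the same player exactly when the number of variables is odd. -/
def LastMoveBy (X : Finset ℕ) (a b : Player) : Prop :=
  a = b ↔ Odd X.card

/-- The numbers of clauses of the `k`-uniform CNFs `φ` for which there is a game instance `(φ, X)`
in which `F` has a winning strategy when `a` has the first move and `b` has the last move. -/
def clauseCounts (k : ℕ) (a b : Player) : Set ℕ :=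
  {m | ∃ (φ : CNF) (X : Finset ℕ), IsInstance φ X ∧ IsUniform k φ ∧ LastMoveBy X a b ∧
    FWins φ X a ∧ φ.card = m}

/-- `M k a b` is the minimum number of clauses of a `k`-uniform CNF on which `F` wins when `a` has
the first move and `b` has the last move. (It would be `0` if there were no such CNF; no attained
value is `0`, so a positive lower bound on `M k a b` also says that the minimum is attained.) -/
noncomputable def M (k : ℕ) (a b : Player) : ℕ :=
  sInf (clauseCounts k a b)

end CNFGame

namespace CNFGame

/-! Lower bounds: a clause with `j` unassigned literals and no true literal gets weight `f j`, with
`f 0 = 1`, and T, when to move, keeps the total below 1, so that no clause ends up falsified. F's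
first move shortens a clause by at most one literal, so F needs at least `1 / f (k - 1)` clauses. T
makes a heaviest literal true; the weight removed pays for the two literals falsified in the round,
one by T and one by F, if one falsified literal costs a factor of at most 3/2 and two at most 2. The
weights `halvingWeight` meet this (`survives_of_potential_lt_one`). If T moves last, even the
weights `(2/3)^j` work, although two falsified literals now cost 9/4: whenever the chosen move has a
bad reply, T can instead reserve the two variables involved and force opposite values on two of
their literals (`Survives.setAside`, `survives_of_potential_lt_one_of_odd`). Upper bounds: F splits
the variables into pairs and answers inside the pair T touches. In `pairCNF` F makes the two values
equal, and the CNF lists both outcomes for each pair. In `fibCNF` F forces a pair `x, z` to have `x`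
false or both true; falsifying these outcomes takes one and two literals respectively, whence the
Fibonacci recursion. -/

/-- The complementary literal. -/
def neg (l : Literal) : Literal := (l.1, !l.2)

@[simp] lemma neg_fst (l : Literal) : (neg l).1 = l.1 := rfl

@[simp] lemma neg_neg (l : Literal) : neg (neg l) = l := by simp [neg]

lemma ne_neg (l : Literal) : l ≠ neg l := by
  rcases l with ⟨x, b⟩
  cases b <;> simp [neg]

lemma eq_or_eq_neg {l m : Literal} (h : m.1 = l.1) : m = l ∨ m = neg l := by
  rcases l with ⟨x, b⟩
  rcases m with ⟨y, c⟩
  obtain rfl : y = x := h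
  cases b <;> cases c <;> simp [neg]

/-! ### Histories -/

lemma mem_unassigned_cons {X : Finset ℕ} {h : History} {m : Move} {x : ℕ} :
    x ∈ unassigned X (m :: h) ↔ x ≠ m.1 ∧ x ∈ unassigned X h := by
  rcases m with ⟨y, c⟩
  simp only [unassigned, Finset.mem_filter, List.mem_cons, Prod.mk.injEq, not_or, not_and]
  constructor
  · rintro ⟨hx, hb⟩
    exact ⟨fun e => (hb c).1 e rfl, hx, fun b => (hb b).2⟩
  · rintro ⟨hne, hx, hb⟩
    exact ⟨hx, fun b => ⟨fun e => absurd e hne, hb b⟩⟩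

lemma unassigned_cons (X : Finset ℕ) (h : History) (m : Move) :
    unassigned X (m :: h) = (unassigned X h).erase m.1 := by
  ext x
  rw [mem_unassigned_cons, Finset.mem_erase]

lemma unassigned_nil (X : Finset ℕ) : unassigned X [] = X := by
  simp [unassigned]

lemma turn_succ (a : Player) (n : ℕ) : turn a (n + 1) = (turn a n).other := by
  unfold turn
  rcases Nat.even_or_odd n with h | h
  · have : ¬ Even (n + 1) := by simpa [Nat.even_add_one] using h
    simp [h, this]
  · have h' : ¬ Even n := by simpa using h
    have : Even (n + 1) := by simpa [Nat.even_add_one] using h'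
    simp only [h', this, if_true, if_false]
    cases a <;> rfl

/-! ### Positions in which `T` wins -/

/-- `T` can satisfy all the clauses of `A` by playing on the variables in `R`, where the literals
whose variables lie outside `R` are false, and `t` is to move. -/
inductive Survives : Player → CNF → Finset ℕ → Prop
  | nil (t : Player) : Survives t ∅ ∅
  | moveT {A : CNF} {R : Finset ℕ} (l : Literal) (hl : l.1 ∈ R) :
      Survives Player.F (A.filter fun C => l ∉ C) (R.erase l.1) → Survives Player.T A R
  | moveF {A : CNF} {R : Finset ℕ} (hR : R.Nonempty) :
      (∀ l : Literal, l.1 ∈ R →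
        Survives Player.T (A.filter fun C => l ∉ C) (R.erase l.1)) → Survives Player.F A R

lemma Survives.mono {t : Player} {A B : CNF} {R : Finset ℕ} (h : Survives t A R) (hB : B ⊆ A) :
    Survives t B R := by
  induction h generalizing B with
  | nil t =>
    rw [Finset.subset_empty.1 hB]
    exact .nil t
  | moveT l hl _ ih => exact .moveT l hl (ih (Finset.filter_subset_filter _ hB))
  | moveF hR _ ih => exact .moveF hR fun l hl => ih l hl (Finset.filter_subset_filter _ hB)

/-- T's winning tree is played against `σ`. Moves and literals are the same pairs, so `l ∈ h` says
that `l` is true; `A` always contains every clause without a true literal. At the end `A` is empty,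
so every clause has a true literal and, the history being consistent, none is falsified. -/
lemma Survives.not_isWinningStrategy {φ : CNF} {X : Finset ℕ} {a : Player} {σ : Strategy}
    (hσ : IsWinningStrategy φ X a σ) {t : Player} {A : CNF} {R : Finset ℕ}
    (hS : Survives t A R) (h : History) (hp : PlayedWith X a σ h) (ht : turn a h.length = t)
    (hR : unassigned X h = R) (hcons : ∀ l ∈ h, neg l ∉ h)
    (hA : ∀ C ∈ φ, (∀ l ∈ C, l ∉ h) → C ∈ A) : False := by
  have key : ∀ (h : History) (l : Literal) (A : CNF), l.1 ∈ unassigned X h →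
      (∀ l ∈ h, neg l ∉ h) → (∀ C ∈ φ, (∀ l ∈ C, l ∉ h) → C ∈ A) →
      (∀ m ∈ l :: h, neg m ∉ l :: h) ∧
      ∀ C ∈ φ, (∀ m ∈ C, m ∉ l :: h) → C ∈ A.filter fun C => l ∉ C := by
    intro h l A hl hcons hA
    have hfree : ∀ m ∈ h, m.1 ≠ l.1 := by
      rintro ⟨x, b⟩ hm rfl
      exact (Finset.mem_filter.1 hl).2 b hm
    refine ⟨?_, ?_⟩
    · intro m hm hm'
      rcases List.mem_cons.1 hm with rfl | hm1 <;> rcases List.mem_cons.1 hm' with h2 | h2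
      · exact ne_neg m h2.symm
      · exact hfree _ h2 rfl
      · exact hfree _ hm1 (by rw [← h2]; rfl)
      · exact hcons _ hm1 h2
    · intro C hC hm
      refine Finset.mem_filter.2 ⟨hA C hC fun m hmC hmh => hm m hmC (List.mem_cons_of_mem _ hmh),
        fun hlC => hm l hlC List.mem_cons_self⟩
  induction hS generalizing h with
  | nil t =>
    obtain ⟨C, hC, hf⟩ := (hσ h hp).2 hR
    refine absurd (hA C hC fun l hl hlh => hcons l hlh (hf l hl)) (Finset.notMem_empty C)
  | moveT l hl _ ih =>
    subst hR
    obtain ⟨h1, h2⟩ := key h l _ hl hcons hA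
    refine ih (l :: h) (.moveT h l hp ht hl) ?_ (unassigned_cons X h l) h1 h2
    rw [List.length_cons, turn_succ, ht]
    rfl
  | moveF hne _ ih =>
    subst hR
    have hl := (hσ h hp).1 ht hne
    obtain ⟨h1, h2⟩ := key h (σ h) _ hl hcons hA
    refine ih (σ h) hl (σ h :: h) (.moveF h hp ht hne) ?_ (unassigned_cons X h _) h1 h2
    rw [List.length_cons, turn_succ, ht]
    rfl

lemma Survives.not_fWins {φ : CNF} {X : Finset ℕ} {a : Player} (hS : Survives a φ X) :
    ¬ FWins φ X a := by
  rintro ⟨σ, hσ⟩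
  exact hS.not_isWinningStrategy hσ [] .start (by simp [turn]) (unassigned_nil X) (by simp)
    fun C hC _ => hC

/-- The clauses that hold whenever exactly one of the literals `l`, `m` is true. -/
abbrev Covered (l m : Literal) (C : Clause) : Prop :=
  (l ∈ C ∧ m ∈ C) ∨ (neg l ∈ C ∧ neg m ∈ C)

/-- `T` may set aside two variables, answering every move of `F` on one of them with a move on the
other, provided that `T` is never forced to move first on them. -/
lemma Survives.setAside {t : Player} {A₀ : CNF} {R₀ : Finset ℕ} (hS : Survives t A₀ R₀)
    (hpar : t = Player.T ↔ Odd R₀.card) {l m : Literal} (hlm : l.1 ≠ m.1) (hl : l.1 ∉ R₀)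
    (hm : m.1 ∉ R₀) {A : CNF} (hA : ∀ C ∈ A, ¬ Covered l m C → C ∈ A₀) :
    Survives t A (insert l.1 (insert m.1 R₀)) := by
  -- T answers on the other variable so that exactly one of `l`, `m` is true. This satisfies every
  -- covered clause; the play then goes on in the position on `R₀`.
  have reply : ∀ {A₀ A : CNF} {R₀ : Finset ℕ}, Survives Player.F A₀ R₀ → l.1 ∉ R₀ → m.1 ∉ R₀ →
      (∀ C ∈ A, ¬ Covered l m C → C ∈ A₀) → ∀ u : Literal, (u.1 = l.1 ∨ u.1 = m.1) →
      Survives Player.T (A.filter fun C => u ∉ C) ((insert l.1 (insert m.1 R₀)).erase u.1) := by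
    intro A₀ A R₀ hS hl hm hA u hu
    have hR1 : ((insert l.1 (insert m.1 R₀)).erase l.1).erase m.1 = R₀ := by
      ext x; simp only [Finset.mem_erase, Finset.mem_insert]; grind
    have hR2 : ((insert l.1 (insert m.1 R₀)).erase m.1).erase l.1 = R₀ := by
      ext x; simp only [Finset.mem_erase, Finset.mem_insert]; grind
    rcases hu with hu | hu <;> rcases eq_or_eq_neg hu with rfl | rfl
    · refine .moveT (neg m) (by simp [Ne.symm hlm]) ?_
      rw [neg_fst, hR1]
      refine hS.mono fun C hC => ?_
      simp only [Finset.mem_filter] at hC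
      exact hA C hC.1.1 (by tauto)
    · refine .moveT m (by simp [Ne.symm hlm]) ?_
      rw [neg_fst, hR1]
      refine hS.mono fun C hC => ?_
      simp only [Finset.mem_filter] at hC
      exact hA C hC.1.1 (by tauto)
    · refine .moveT (neg l) (by simp [hlm]) ?_
      rw [neg_fst, hR2]
      refine hS.mono fun C hC => ?_
      simp only [Finset.mem_filter] at hC
      exact hA C hC.1.1 (by tauto)
    · refine .moveT l (by simp [hlm]) ?_
      rw [neg_fst, hR2]
      refine hS.mono fun C hC => ?_
      simp only [Finset.mem_filter] at hC
      exact hA C hC.1.1 (by tauto)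
  have erase_insert : ∀ (R : Finset ℕ) (x : ℕ), x ≠ l.1 → x ≠ m.1 →
      (insert l.1 (insert m.1 R)).erase x = insert l.1 (insert m.1 (R.erase x)) := by
    intro R x h1 h2
    rw [Finset.erase_insert_of_ne (Ne.symm h1), Finset.erase_insert_of_ne (Ne.symm h2)]
  have filter_cov : ∀ {A A₀ : CNF} (u : Literal), (∀ C ∈ A, ¬ Covered l m C → C ∈ A₀) →
      ∀ C ∈ A.filter (fun C => u ∉ C), ¬ Covered l m C → C ∈ A₀.filter fun C => u ∉ C := by
    intro A A₀ u hA C hC hcov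
    rw [Finset.mem_filter] at hC ⊢
    exact ⟨hA C hC.1 hcov, hC.2⟩
  induction hS generalizing A with
  | nil t =>
    cases t with
    -- By parity T never has to move when only the reserved pair is left.
    | T => simp at hpar
    | F =>
      refine .moveF (by simp) fun u hu => ?_
      refine reply (.nil _) hl hm hA u (by simpa using hu)
  | @moveT A₀ R₀ u hu _ ih =>
    have h1 : u.1 ≠ l.1 := fun e => hl (e ▸ hu)
    have h2 : u.1 ≠ m.1 := fun e => hm (e ▸ hu)
    refine .moveT u (by simp [hu]) ?_
    rw [erase_insert _ _ h1 h2]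
    refine ih ?_ (by simp [hl]) (by simp [hm]) (filter_cov u hA)
    have := Finset.card_erase_add_one hu
    simp only [true_iff, reduceCtorEq, false_iff] at hpar ⊢
    rw [← this] at hpar
    simpa [Nat.odd_add_one] using hpar
  | @moveF A₀ R₀ hne hF ih =>
    refine .moveF (by simp) fun u hu => ?_
    by_cases h12 : u.1 = l.1 ∨ u.1 = m.1
    · exact reply (.moveF hne hF) hl hm hA u h12
    · obtain ⟨h1, h2⟩ := not_or.1 h12
      have hu' : u.1 ∈ R₀ := by simpa [h1, h2] using hu
      rw [erase_insert _ _ h1 h2]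
      refine ih u hu' ?_ (by simp [hl]) (by simp [hm]) (filter_cov u hA)
      have := Finset.card_erase_add_one hu'
      simp only [true_iff, reduceCtorEq, false_iff] at hpar ⊢
      rw [← this] at hpar
      simpa [Nat.odd_add_one] using hpar

/-! ### Potentials -/

/-- The number of literals of `C` whose variables lie in `R`. -/
def width (R : Finset ℕ) (C : Clause) : ℕ := (C.filter fun l => l.1 ∈ R).card

/-- The potential of a position, when a clause of width `j` has weight `f j`. -/
def potential (f : ℕ → ℝ) (A : CNF) (R : Finset ℕ) : ℝ := ∑ C ∈ A, f (width R C)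

/-- No clause contains two complementary literals. -/
def Consistent (A : CNF) : Prop := ∀ C ∈ A, ∀ l ∈ C, neg l ∉ C

lemma Consistent.mono {A B : CNF} (h : Consistent A) (hB : B ⊆ A) : Consistent B :=
  fun C hC => h C (hB hC)

lemma width_eq {R : Finset ℕ} {l : Literal} (hl : l.1 ∈ R) (C : Clause) :
    width R C = width (R.erase l.1) C + (if l ∈ C then 1 else 0) + if neg l ∈ C then 1 else 0 := by
  unfold width
  rw [Finset.card_filter, Finset.card_filter, ← Finset.sum_ite_eq' C l fun _ => 1,
    ← Finset.sum_ite_eq' C (neg l) fun _ => 1, ← Finset.sum_add_distrib, ← Finset.sum_add_distrib]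
  refine Finset.sum_congr rfl fun u _ => ?_
  by_cases hu : u.1 = l.1
  · have hne := ne_neg l
    rcases eq_or_eq_neg hu with rfl | rfl
    · simp [hl, hne]
    · simp [hl, hne.symm]
  · have h1 : u ≠ l := fun e => hu (by rw [e])
    have h2 : u ≠ neg l := fun e => hu (by rw [e]; rfl)
    simp [hu, h1, h2]

lemma eq_empty_of_potential_lt_one {f : ℕ → ℝ} (h0 : f 0 = 1) {A : CNF}
    (hW : potential f A ∅ < 1) : A = ∅ := by
  have : potential f A ∅ = A.card := by simp [potential, width, h0]
  rw [this] at hW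
  exact Finset.card_eq_zero.1 (by exact_mod_cast Nat.lt_one_iff.1 (by exact_mod_cast hW))

/-- The weight of the clauses that contain the literal `l`. -/
def litWeight (f : ℕ → ℝ) (A : CNF) (R : Finset ℕ) (l : Literal) : ℝ :=
  ∑ C ∈ A, (if l ∈ C then 1 else 0) * f (width R C)

lemma exists_max_literal {R : Finset ℕ} (hR : R.Nonempty) (g : Literal → ℝ) :
    ∃ l : Literal, l.1 ∈ R ∧ ∀ m : Literal, m.1 ∈ R → g m ≤ g l := by
  obtain ⟨x, hx⟩ := hR
  obtain ⟨l, hl, hmax⟩ := (R ×ˢ (Finset.univ : Finset Bool)).exists_max_image g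
    ⟨(x, true), by simp [hx]⟩
  exact ⟨l, (Finset.mem_product.1 hl).1, fun m hm => hmax m (by simp [hm])⟩

section OneMove

variable {f : ℕ → ℝ} {A : CNF} {R : Finset ℕ} {l m : Literal}

/-- A move changes the weight of a clause by a factor of at most `3 / 2`. -/
lemma potential_move_le (hf : ∀ j, 0 ≤ f j) (h1 : ∀ j, f j ≤ 3 / 2 * f (j + 1))
    (hl : l.1 ∈ R) :
    potential f (A.filter fun C => l ∉ C) (R.erase l.1) ≤
      potential f A R - litWeight f A R l + 1 / 2 * litWeight f A R (neg l) := by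
  unfold potential litWeight
  rw [Finset.sum_filter, ← Finset.sum_sub_distrib, Finset.mul_sum, ← Finset.sum_add_distrib]
  refine Finset.sum_le_sum fun C _ => ?_
  rw [width_eq hl C]
  set j := width (R.erase l.1) C
  have := hf (j + 1)
  have := h1 j
  have := hf j
  have := hf (j + 1 + 1)
  by_cases ha : l ∈ C <;> by_cases hb : neg l ∈ C <;> simp [ha, hb] <;> linarith

lemma width_eq_two (hl : l.1 ∈ R) (hm : m.1 ∈ R.erase l.1) (C : Clause) :
    width R C = width ((R.erase l.1).erase m.1) C + (if m ∈ C then 1 else 0) +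
      (if neg m ∈ C then 1 else 0) + (if l ∈ C then 1 else 0) + if neg l ∈ C then 1 else 0 := by
  rw [width_eq hl C, width_eq hm C]

end OneMove

/-- If the potential is less than `1`, a clause gains a factor of at most `3 / 2` when one literal
is falsified and of at most `2` when two are, then `T` wins by satisfying the heaviest literal. -/
theorem survives_of_potential_lt_one {f : ℕ → ℝ} (h0 : f 0 = 1) (hf : ∀ j, 0 ≤ f j)
    (h1 : ∀ j, f j ≤ 3 / 2 * f (j + 1)) (h2 : ∀ j, f j ≤ 2 * f (j + 2)) (R : Finset ℕ) :
    ∀ A : CNF, Consistent A → potential f A R < 1 → Survives Player.T A R := by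
  induction R using Finset.strongInduction with
  | H R ih =>
  intro A hA hW
  rcases R.eq_empty_or_nonempty with rfl | hR
  · rw [eq_empty_of_potential_lt_one h0 hW]
    exact .nil _
  obtain ⟨l, hl, hmax⟩ := exists_max_literal hR (litWeight f A R)
  refine .moveT l hl ?_
  have hnl := hmax (neg l) hl
  rcases (R.erase l.1).eq_empty_or_nonempty with he | hne
  · have hlt : potential f (A.filter fun C => l ∉ C) (R.erase l.1) < 1 := by
      have := potential_move_le (A := A) hf h1 hl
      have h3 : 0 ≤ litWeight f A R l :=
        Finset.sum_nonneg fun C _ => mul_nonneg (by split_ifs <;> norm_num) (hf _)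
      linarith
    rw [he] at hlt ⊢
    rw [eq_empty_of_potential_lt_one h0 hlt]
    exact .nil _
  refine .moveF hne fun m hm => ?_
  have hm' := Finset.mem_erase.1 hm
  refine ih _ ((Finset.erase_subset _ _).trans_ssubset (Finset.erase_ssubset hl)) _
    (hA.mono ((Finset.filter_subset _ _).trans (Finset.filter_subset _ _))) ?_
  refine lt_of_le_of_lt ?_ hW
  have hnm := hmax (neg m) hm'.2
  -- F makes `m` true and so falsifies `neg m`. A clause containing both `neg l` and `neg m` grows
  -- by a factor of at most 2 = 1 + 1/2 + 1/2, which is why the two increments may be added. By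
  -- maximality of `l` they total at most its weight.
  have key : potential f ((A.filter fun C => l ∉ C).filter fun C => m ∉ C)
      ((R.erase l.1).erase m.1) ≤ potential f A R - litWeight f A R l
        + 1 / 2 * litWeight f A R (neg l) + 1 / 2 * litWeight f A R (neg m) := by
    unfold potential litWeight
    rw [Finset.sum_filter, Finset.sum_filter, Finset.mul_sum, Finset.mul_sum,
      ← Finset.sum_sub_distrib, ← Finset.sum_add_distrib, ← Finset.sum_add_distrib]
    refine Finset.sum_le_sum fun C hC => ?_
    have hcl := hA C hC l
    have hcm := hA C hC m
    rw [width_eq_two hl hm C]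
    set j := width ((R.erase l.1).erase m.1) C
    have := hf (j + 1)
    have := h1 j
    have := hf j
    have := hf (j + 1 + 1)
    have := h2 j
    by_cases ha : l ∈ C <;> by_cases hb : neg l ∈ C <;> by_cases hc : m ∈ C <;>
      by_cases hd : neg m ∈ C <;> simp [ha, hb, hc, hd] at hcl hcm ⊢ <;> linarith
  linarith

/-- If `T` also has the last move, then the weights `(2 / 3) ^ j` suffice: either some literal is a
good move, or there are two variables that `T` can set aside. -/
theorem survives_of_potential_lt_one_of_odd (n : ℕ) :
    ∀ (R : Finset ℕ) (A : CNF), R.card = n → Odd n → Consistent A →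
      potential (fun j => (2 / 3) ^ j) A R < 1 → Survives Player.T A R := by
  induction n using Nat.strong_induction_on with
  | _ n ih =>
  intro R A hn hodd hA hW
  set f : ℕ → ℝ := fun j => (2 / 3) ^ j with hfdef
  have h0 : f 0 = 1 := by simp [hfdef]
  have hf : ∀ j, 0 ≤ f j := fun j => by positivity
  have hs : ∀ j, f (j + 1) = 2 / 3 * f j := fun j => by simp only [hfdef]; ring
  have h1 : ∀ j, f j ≤ 3 / 2 * f (j + 1) := fun j => by rw [hs]; linarith
  have hR : R.Nonempty := Finset.card_pos.1 (hn ▸ hodd.pos)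
  -- The maximized quantity is the decrease of the potential caused by T's move alone.
  obtain ⟨l, hl, hmax⟩ := exists_max_literal hR
    (fun l => litWeight f A R l - 1 / 2 * litWeight f A R (neg l))
  have hnl := hmax (neg l) hl
  simp only [neg_neg] at hnl
  by_cases hgood : ∀ m : Literal, m.1 ∈ R.erase l.1 →
      potential f ((A.filter fun C => l ∉ C).filter fun C => m ∉ C) ((R.erase l.1).erase m.1) < 1
  · refine .moveT l hl ?_
    rcases (R.erase l.1).eq_empty_or_nonempty with he | hne
    · have hlt : potential f (A.filter fun C => l ∉ C) (R.erase l.1) < 1 := by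
        have := potential_move_le (A := A) hf h1 hl
        have h3 : 0 ≤ litWeight f A R l :=
          Finset.sum_nonneg fun C _ => mul_nonneg (by split_ifs <;> norm_num) (hf _)
        linarith
      rw [he] at hlt ⊢
      rw [eq_empty_of_potential_lt_one h0 hlt]
      exact .nil _
    · refine .moveF hne fun m hm => ?_
      have hc1 := Finset.card_erase_add_one hl
      have hc2 := Finset.card_erase_add_one hm
      refine ih (n - 2) (by omega) _ _ (by omega) (by grind)
        (hA.mono ((Finset.filter_subset _ _).trans (Finset.filter_subset _ _))) (hgood m hm)
  · push Not at hgood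
    obtain ⟨m, hm, hbad⟩ := hgood
    have hm' := Finset.mem_erase.1 hm
    have hc1 := Finset.card_erase_add_one hl
    have hc2 := Finset.card_erase_add_one hm
    have hnm := hmax (neg m) hm'.2
    simp only [neg_neg] at hnm
    -- The multipliers 5, 3, 3/2 make the inequality hold clause by clause, with equality for
    -- clauses meeting the two variables in exactly `l`, `neg l`, `neg m`, or `l` and `m`. The last
    -- three terms are nonnegative, by `hbad` and the choice of `l`, so setting the pair aside does
    -- not increase the potential.
    have key : potential f (A.filter fun C => ¬ Covered l m C) ((R.erase l.1).erase m.1)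
          - potential f A R
        + 5 * (potential f ((A.filter fun C => l ∉ C).filter fun C => m ∉ C)
            ((R.erase l.1).erase m.1) - potential f A R)
        + 3 * ((litWeight f A R l - 1 / 2 * litWeight f A R (neg l)) -
            (litWeight f A R (neg m) - 1 / 2 * litWeight f A R m))
        + 3 / 2 * (litWeight f A R l - litWeight f A R (neg l)) ≤ 0 := by
      unfold potential litWeight
      rw [Finset.sum_filter, Finset.sum_filter, Finset.sum_filter]
      simp only [Finset.mul_sum, ← Finset.sum_sub_distrib, ← Finset.sum_add_distrib]
      refine Finset.sum_nonpos fun C hC => ?_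
      have hcl := hA C hC l
      have hcm := hA C hC m
      rw [width_eq_two hl hm C]
      set j := width ((R.erase l.1).erase m.1) C
      have := hf j
      have hj1 := hs j
      have hj2 := hs (j + 1)
      by_cases ha : l ∈ C <;> by_cases hb : neg l ∈ C <;> by_cases hc : m ∈ C <;>
        by_cases hd : neg m ∈ C <;> simp [ha, hb, hc, hd] at hcl hcm ⊢ <;> linarith
    have hlt : potential f (A.filter fun C => ¬ Covered l m C) ((R.erase l.1).erase m.1) < 1 := by
      linarith
    have hodd' : Odd ((R.erase l.1).erase m.1).card := by grind
    have hS := ih (n - 2) (by omega) _ _ (by omega) (by grind)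
      (hA.mono (Finset.filter_subset _ _)) hlt
    have := hS.setAside (by simp [hodd']) (Ne.symm hm'.1) (by simp) (by simp) (A := A)
      fun C hC hcov => Finset.mem_filter.2 ⟨hC, hcov⟩
    rwa [Finset.insert_erase hm, Finset.insert_erase hl] at this

/-! ### Lower bounds -/

lemma IsUniform.consistent {k : ℕ} {φ : CNF} (h : IsUniform k φ) : Consistent φ := by
  intro C hC l hl hnl
  have hinj : Set.InjOn Prod.fst (C : Set Literal) :=
    Finset.card_image_iff.1 ((h C hC).2.trans (h C hC).1.symm)
  exact ne_neg l (hinj hl hnl rfl)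

lemma width_of_isInstance {k : ℕ} {φ : CNF} {X : Finset ℕ} (hX : IsInstance φ X)
    (hu : IsUniform k φ) {C : Clause} (hC : C ∈ φ) : width X C = k := by
  rw [width, Finset.filter_true_of_mem (hX C hC), (hu C hC).1]

/-- The potential after the first move of `F`. -/
lemma potential_first_move_lt {k : ℕ} {φ : CNF} {X : Finset ℕ} (hX : IsInstance φ X)
    (hu : IsUniform k φ) {f : ℕ → ℝ} (hf : Antitone f) (hlt : φ.card * f (k - 1) < 1)
    (h0 : ∀ j, 0 ≤ f j) {l : Literal} (hl : l.1 ∈ X) :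
    potential f (φ.filter fun C => l ∉ C) (X.erase l.1) < 1 := by
  refine lt_of_le_of_lt ?_ hlt
  have hle : ∀ C ∈ φ.filter fun C => l ∉ C, f (width (X.erase l.1) C) ≤ f (k - 1) := by
    intro C hC
    rw [Finset.mem_filter] at hC
    refine hf ?_
    -- Only `neg l` can be lost. For `k = 0` the truncated `k - 1` is 0, the width of the empty
    -- clause.
    have := width_eq hl C
    rw [width_of_isInstance hX hu hC.1, if_neg hC.2] at this
    split_ifs at this <;> omega
  refine (Finset.sum_le_card_nsmul _ _ _ hle).trans ?_
  rw [nsmul_eq_mul]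
  exact mul_le_mul_of_nonneg_right (by exact_mod_cast Finset.card_filter_le _ _) (h0 _)

/-- The weights used when `F` has the last move: `1, 2/3, 1/2, 1/3, 1/4, 1/6, …`. -/
noncomputable def halvingWeight (j : ℕ) : ℝ := (1 / 2) ^ (j / 2) * if Even j then 1 else 2 / 3

lemma halvingWeight_even (m : ℕ) : halvingWeight (2 * m) = (1 / 2) ^ m := by
  simp [halvingWeight]

lemma halvingWeight_odd (m : ℕ) : halvingWeight (2 * m + 1) = (1 / 2) ^ m * (2 / 3) := by
  have h : (2 * m + 1) / 2 = m := by omega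
  simp [halvingWeight, h]

lemma halvingWeight_nonneg (j : ℕ) : 0 ≤ halvingWeight j := by
  unfold halvingWeight
  split_ifs <;> positivity

lemma halvingWeight_add_two (j : ℕ) : halvingWeight (j + 2) = 1 / 2 * halvingWeight j := by
  have h : (j + 2) / 2 = j / 2 + 1 := by omega
  have h' : Even (j + 2) ↔ Even j := by simp [parity_simps]
  simp only [halvingWeight, h, h', pow_succ]
  ring

/-- The factor 3/2 is attained at every even `j`. The smoother weights `√2 ^ (-j)` would also be
admissible, but give only `√2 ^ (k - 1)` for even `k`. -/
lemma halvingWeight_succ_bounds (j : ℕ) : halvingWeight (j + 1) ≤ halvingWeight j ∧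
    halvingWeight j ≤ 3 / 2 * halvingWeight (j + 1) := by
  obtain ⟨m, rfl | rfl⟩ := Nat.even_or_odd' j
  · rw [halvingWeight_even, halvingWeight_odd]
    have : (0 : ℝ) < (1 / 2) ^ m := by positivity
    constructor <;> linarith
  · rw [halvingWeight_odd, show 2 * m + 1 + 1 = 2 * (m + 1) by ring, halvingWeight_even, pow_succ]
    have : (0 : ℝ) < (1 / 2) ^ m := by positivity
    constructor <;> linarith

/-- Few clauses are not enough for `F` when `F` has the first and the last move. -/
theorem one_le_mul_halvingWeight {k m : ℕ} (hm : m ∈ clauseCounts k Player.F Player.F) :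
    1 ≤ m * halvingWeight (k - 1) := by
  obtain ⟨φ, X, hX, hu, hlast, hwin, rfl⟩ := hm
  by_contra! hlt
  have hne : X.Nonempty := Finset.card_pos.1 (Odd.pos (hlast.1 rfl))
  refine Survives.not_fWins (.moveF hne fun l hl => ?_) hwin
  exact survives_of_potential_lt_one (by simpa using halvingWeight_even 0) halvingWeight_nonneg
    (fun j => (halvingWeight_succ_bounds j).2) (fun j => by rw [halvingWeight_add_two]; linarith) _ _
    (hu.consistent.mono (Finset.filter_subset _ _))
    (potential_first_move_lt hX hu (antitone_nat_of_succ_le fun j => (halvingWeight_succ_bounds j).1)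
      hlt halvingWeight_nonneg hl)

/-- Few clauses are not enough for `F` when `F` has the first and `T` the last move. -/
theorem one_le_mul_two_thirds_pow {k m : ℕ} (hm : m ∈ clauseCounts k Player.F Player.T) :
    1 ≤ m * (2 / 3 : ℝ) ^ (k - 1) := by
  obtain ⟨φ, X, hX, hu, hlast, hwin, rfl⟩ := hm
  by_contra! hlt
  have heven : ¬ Odd X.card := fun h => by simpa using hlast.2 h
  -- An even number of variables may be zero; F then has no first move, and any clause is empty.
  rcases X.eq_empty_or_nonempty with rfl | hne
  · have hφ : φ = ∅ := by
      rw [Finset.eq_empty_iff_forall_notMem]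
      intro C hC
      have hk := width_of_isInstance hX hu hC
      have hk0 : k = 0 := by simpa [width] using hk.symm
      subst hk0
      have : φ.card < 1 := by exact_mod_cast (by simpa using hlt : (φ.card : ℝ) < 1)
      exact absurd (Finset.card_pos.2 ⟨C, hC⟩) (by omega)
    subst hφ
    exact (Survives.nil _).not_fWins hwin
  · refine Survives.not_fWins (.moveF hne fun l hl => ?_) hwin
    have hc := Finset.card_erase_add_one hl
    refine survives_of_potential_lt_one_of_odd _ _ _ rfl (by grind)
      (hu.consistent.mono (Finset.filter_subset _ _))
      (potential_first_move_lt hX hu (f := fun j => (2 / 3) ^ j)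
        (pow_right_anti₀ (by norm_num) (by norm_num)) hlt (fun j => by positivity) hl)

/-! ### Upper bounds -/

/-- `F` wins if, after some first move, every move of `T` has a reply that keeps an invariant. -/
theorem fWins_of_replies {φ : CNF} {X : Finset ℕ} (P : History → Prop) (m₀ : Move)
    (hm₀ : m₀.1 ∈ X) (h₀ : P [m₀])
    (hstep : ∀ h m, P h → m.1 ∈ unassigned X h → (unassigned X (m :: h)).Nonempty →
      ∃ m' : Move, m'.1 ∈ unassigned X (m :: h) ∧ P (m' :: m :: h))
    (hend : ∀ h, P h → unassigned X h = ∅ → Unsatisfied φ h)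
    (hend' : ∀ h m, P h → m.1 ∈ unassigned X h → unassigned X (m :: h) = ∅ →
      Unsatisfied φ (m :: h)) : FWins φ X Player.F := by
  classical
  let Q : History → Prop := fun h => h = [] ∨ ∃ m h', h = m :: h' ∧ P h' ∧ m.1 ∈ unassigned X h'
  have hQ : ∀ h, Q h → (unassigned X h).Nonempty →
      ∃ m' : Move, m'.1 ∈ unassigned X h ∧ P (m' :: h) := by
    rintro h (rfl | ⟨m, h, rfl, hP, hm⟩) hne
    · exact ⟨m₀, by rwa [unassigned_nil], h₀⟩
    · exact hstep h m hP hm hne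
  choose! σ hσ using hQ
  have hinv : ∀ h, PlayedWith X Player.F σ h →
      (turn Player.F h.length = Player.T → P h) ∧ (turn Player.F h.length = Player.F → Q h) := by
    intro h hp
    induction hp with
    | start => exact ⟨fun h => by simp [turn] at h, fun _ => Or.inl rfl⟩
    | moveT h m _ ht hm ih =>
      rw [List.length_cons, turn_succ, ht]
      exact ⟨fun h => by simp [Player.other] at h, fun _ => Or.inr ⟨m, h, rfl, ih.1 ht, hm⟩⟩
    | moveF h _ ht hne ih =>
      rw [List.length_cons, turn_succ, ht]
      exact ⟨fun _ => (hσ h (ih.2 ht) hne).2, fun h => by simp [Player.other] at h⟩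
  refine ⟨σ, fun h hp => ⟨fun ht hne => (hσ h ((hinv h hp).2 ht) hne).1, fun hemp => ?_⟩⟩
  cases ht : turn Player.F h.length with
  | T => exact hend h ((hinv h hp).1 ht) hemp
  | F =>
    rcases (hinv h hp).2 ht with rfl | ⟨m, h', rfl, hP, hm⟩
    · rw [unassigned_nil] at hemp
      simp [hemp] at hm₀
    · exact hend' h' m hP hm hemp

/-- A clause with `k` literals, on `k` distinct variables that are less than `v`. -/
def ClauseBelow (k v : ℕ) (C : Clause) : Prop :=
  C.card = k ∧ (C.image Prod.fst).card = k ∧ ∀ l ∈ C, l.1 < v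

lemma ClauseBelow.mono {k v w : ℕ} {C : Clause} (h : ClauseBelow k v C) (hvw : v ≤ w) :
    ClauseBelow k w C :=
  ⟨h.1, h.2.1, fun l hl => (h.2.2 l hl).trans_le hvw⟩

lemma ClauseBelow.insert {k v : ℕ} {C : Clause} (h : ClauseBelow k v C) (b : Bool) :
    ClauseBelow (k + 1) (v + 1) (insert (v, b) C) := by
  refine ⟨?_, ?_, ?_⟩
  · rw [Finset.card_insert_of_notMem fun hl => lt_irrefl v (h.2.2 _ hl), h.1]
  · rw [Finset.image_insert, Finset.card_insert_of_notMem, h.2.1]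
    intro hv
    obtain ⟨l, hl, hlv⟩ := Finset.mem_image.1 hv
    exact (h.2.2 l hl).ne hlv
  · intro l hl
    rcases Finset.mem_insert.1 hl with rfl | hl
    · exact Nat.lt_succ_self v
    · exact (h.2.2 l hl).trans (Nat.lt_succ_self v)

lemma clauseBelow_empty (v : ℕ) : ClauseBelow 0 v ∅ := by simp [ClauseBelow]

lemma isInstance_of_clauseBelow {k v : ℕ} {φ : CNF} (h : ∀ C ∈ φ, ClauseBelow k v C) :
    IsInstance φ (Finset.range v) :=
  fun C hC l hl => Finset.mem_range.2 ((h C hC).2.2 l hl)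

lemma isUniform_of_clauseBelow {k v : ℕ} {φ : CNF} (h : ∀ C ∈ φ, ClauseBelow k v C) :
    IsUniform k φ :=
  fun C hC => ⟨(h C hC).1, (h C hC).2.1⟩

/-! ### Upper bound when F moves last: pairs with equal values -/

/-- The clauses obtained from `B` by adding, for each of the pairs of variables `2 i + 1`,
`2 i + 2` with `i < p`, either the two positive or the two negative literals. -/
def pairCNF (B : Clause) : ℕ → CNF
  | 0 => {B}
  | p + 1 => (Finset.univ : Finset Bool).biUnion fun b =>
      (pairCNF B p).image fun C => insert (2 * p + 1 + 1, b) (insert (2 * p + 1, b) C)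

lemma card_pairCNF_le (B : Clause) (p : ℕ) : (pairCNF B p).card ≤ 2 ^ p := by
  induction p with
  | zero => simp [pairCNF]
  | succ p ih =>
    refine (Finset.card_biUnion_le_card_mul _ _ _ fun b _ =>
      Finset.card_image_le.trans ih).trans ?_
    simp [pow_succ, mul_comm]

lemma clauseBelow_pairCNF {B : Clause} {j : ℕ} (hB : ClauseBelow j 1 B) (p : ℕ) :
    ∀ C ∈ pairCNF B p, ClauseBelow (j + 2 * p) (2 * p + 1) C := by
  induction p with
  | zero => simpa [pairCNF] using hB
  | succ p ih =>
    intro C hC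
    simp only [pairCNF, Finset.mem_biUnion, Finset.mem_image] at hC
    obtain ⟨b, -, C, hC, rfl⟩ := hC
    exact ((ih C hC).insert b).insert b

lemma exists_falsified_pairCNF {B : Clause} {h : History} (hB : ∀ l ∈ B, (l.1, !l.2) ∈ h) {p : ℕ}
    (hp : ∀ i < p, ∃ b : Bool, (2 * i + 1, b) ∈ h ∧ (2 * i + 2, b) ∈ h) :
    Unsatisfied (pairCNF B p) h := by
  induction p with
  | zero => exact ⟨B, by simp [pairCNF], hB⟩
  | succ p ih =>
    obtain ⟨C, hC, hf⟩ := ih fun i hi => hp i (hi.trans (Nat.lt_succ_self p))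
    obtain ⟨b, h1, h2⟩ := hp p (Nat.lt_succ_self p)
    refine ⟨insert (2 * p + 1 + 1, !b) (insert (2 * p + 1, !b) C), ?_, ?_⟩
    · simp only [pairCNF, Finset.mem_biUnion, Finset.mem_image]
      exact ⟨!b, Finset.mem_univ _, C, hC, rfl⟩
    · intro l hl
      simp only [Finset.mem_insert] at hl
      rcases hl with rfl | rfl | hl
      · simpa using h2
      · simpa using h1
      · exact hf l hl

lemma mem_unassigned {X : Finset ℕ} {h : History} {x : ℕ} :
    x ∈ unassigned X h ↔ x ∈ X ∧ ∀ b : Bool, (x, b) ∉ h := Finset.mem_filter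

/-- F opens by making variable 0 false, then copies T's value to the partner variable. With `B = ∅`
variable 0 is a dummy absorbing the opening move, which handles even `k`. -/
lemma fWins_pairCNF {B : Clause} (hB : B ⊆ {(0, true)}) (p : ℕ) :
    FWins (pairCNF B p) (Finset.range (2 * p + 1)) Player.F := by
  set X := Finset.range (2 * p + 1)
  let P : History → Prop := fun h => (0, false) ∈ h ∧ ∀ i < p,
    (2 * i + 1 ∈ unassigned X h ∧ 2 * i + 2 ∈ unassigned X h) ∨
      ∃ b : Bool, (2 * i + 1, b) ∈ h ∧ (2 * i + 2, b) ∈ h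
  have hpair : ∀ h (m : Move), P h → m.1 ∈ unassigned X h →
      ∃ i < p, 2 * i + 1 ∈ unassigned X h ∧ 2 * i + 2 ∈ unassigned X h ∧
        (m.1 = 2 * i + 1 ∨ m.1 = 2 * i + 2) := by
    intro h m hP hm
    obtain ⟨hmX, hmf⟩ := mem_unassigned.1 hm
    have hlt := Finset.mem_range.1 hmX
    have h0 : m.1 ≠ 0 := fun e => hmf false (e ▸ hP.1)
    obtain ⟨i, hi, hmi⟩ : ∃ i < p, m.1 = 2 * i + 1 ∨ m.1 = 2 * i + 2 :=
      ⟨(m.1 - 1) / 2, by omega, by omega⟩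
    rcases hP.2 i hi with ⟨h1, h2⟩ | ⟨b, h1, h2⟩
    · exact ⟨i, hi, h1, h2, hmi⟩
    · rcases hmi with e | e
      · exact absurd h1 (e ▸ hmf b)
      · exact absurd h2 (e ▸ hmf b)
  have hkeep : ∀ (h : History) (m m' : Move) (i : ℕ), P h → m.2 = m'.2 →
      ((m.1 = 2 * i + 1 ∧ m'.1 = 2 * i + 2) ∨ (m.1 = 2 * i + 2 ∧ m'.1 = 2 * i + 1)) →
      P (m' :: m :: h) := by
    rintro h ⟨x, b⟩ ⟨y, c⟩ i hP hbc hxy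
    obtain rfl : b = c := hbc
    refine ⟨by simp [hP.1], fun i' hi' => ?_⟩
    simp only at hxy
    by_cases hii : i' = i
    · right
      refine ⟨b, ?_⟩
      subst hii
      rcases hxy with ⟨rfl, rfl⟩ | ⟨rfl, rfl⟩ <;> simp
    · rcases hP.2 i' hi' with ⟨h1, h2⟩ | ⟨d, h1, h2⟩
      · left
        simp only [mem_unassigned_cons]
        exact ⟨⟨by omega, by omega, h1⟩, by omega, by omega, h2⟩
      · exact Or.inr ⟨d, by simp [h1], by simp [h2]⟩
  refine fWins_of_replies P (0, false) (by simp [X]) ?_ ?_ ?_ ?_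
  · refine ⟨by simp, fun i hi => Or.inl ?_⟩
    simp only [mem_unassigned_cons, unassigned_nil, X, Finset.mem_range]
    omega
  · intro h m hP hm _
    obtain ⟨i, hi, h1, h2, hmi | hmi⟩ := hpair h m hP hm
    · exact ⟨(2 * i + 2, m.2), mem_unassigned_cons.2 ⟨by simp [hmi], h2⟩,
        hkeep h m _ i hP rfl (by simp [hmi])⟩
    · exact ⟨(2 * i + 1, m.2), mem_unassigned_cons.2 ⟨by simp [hmi], h1⟩,
        hkeep h m _ i hP rfl (by simp [hmi])⟩
  · intro h hP hemp
    refine exists_falsified_pairCNF (fun l hl => ?_) fun i hi => ?_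
    · obtain rfl : l = (0, true) := by simpa using hB hl
      exact hP.1
    · exact (hP.2 i hi).resolve_left fun h1 => by simp [hemp] at h1
  -- Vacuous: after T's move the partner variable is still free.
  · intro h m hP hm hemp
    obtain ⟨i, hi, h1, h2, hmi⟩ := hpair h m hP hm
    rw [Finset.eq_empty_iff_forall_notMem] at hemp
    rcases hmi with hmi | hmi
    · exact absurd (mem_unassigned_cons.2 ⟨by omega, h2⟩) (hemp (2 * i + 2))
    · exact absurd (mem_unassigned_cons.2 ⟨by omega, h1⟩) (hemp (2 * i + 1))

lemma exists_clauseCounts_le_pow {B : Clause} (hB : B ⊆ {(0, true)}) {j : ℕ}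
    (hj : ClauseBelow j 1 B) (p : ℕ) :
    ∃ m ∈ clauseCounts (j + 2 * p) Player.F Player.F, m ≤ 2 ^ p := by
  have h := clauseBelow_pairCNF hj p
  exact ⟨_, ⟨pairCNF B p, Finset.range (2 * p + 1), isInstance_of_clauseBelow h,
    isUniform_of_clauseBelow h, by simp [LastMoveBy], fWins_pairCNF hB p, rfl⟩,
    card_pairCNF_le B p⟩

/-! ### Upper bound when T moves last: the Fibonacci construction -/

/-- The CNFs with Fibonacci many clauses, on the pairs of variables `2 i`, `2 i + 1`. -/
def fibCNF : ℕ → CNF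
  | 0 => {∅}
  | 1 => {{(0, true)}}
  | n + 2 => ((fibCNF (n + 1)).image fun C => insert (2 * (n + 1), true) C) ∪
      (fibCNF n).image fun C =>
        insert (2 * (n + 1) + 1, false) (insert (2 * (n + 1), false) C)

lemma card_fibCNF_le (n : ℕ) : (fibCNF n).card ≤ Nat.fib (n + 1) := by
  induction n using Nat.twoStepInduction with
  | zero => simp [fibCNF]
  | one => simp [fibCNF]
  | more n ih1 ih2 =>
    rw [show n + 2 + 1 = (n + 1) + 2 by ring, Nat.fib_add_two, add_comm (Nat.fib (n + 1))]
    exact (Finset.card_union_le _ _).trans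
      (add_le_add (Finset.card_image_le.trans ih2) (Finset.card_image_le.trans ih1))

lemma clauseBelow_fibCNF (n : ℕ) : ∀ C ∈ fibCNF n, ClauseBelow n (2 * n) C := by
  induction n using Nat.twoStepInduction with
  | zero => simpa [fibCNF] using clauseBelow_empty 0
  | one =>
    intro C hC
    obtain rfl : C = {(0, true)} := by simpa [fibCNF] using hC
    simp [ClauseBelow]
  | more n ih1 ih2 =>
    intro C hC
    simp only [fibCNF, Finset.mem_union, Finset.mem_image] at hC
    rcases hC with ⟨C, hC, rfl⟩ | ⟨C, hC, rfl⟩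
    · exact ((ih2 C hC).insert true).mono (by omega)
    · exact ((((ih1 C hC).mono (by omega : 2 * n ≤ 2 * (n + 1))).insert false).insert false).mono
        (by omega)

/-- The two variables `2 i`, `2 i + 1` are assigned, and `2 i` is false or both are true. -/
def PairSettled (h : History) (i : ℕ) : Prop :=
  (∃ b : Bool, (2 * i + 1, b) ∈ h) ∧
    ((2 * i, false) ∈ h ∨ (2 * i, true) ∈ h ∧ (2 * i + 1, true) ∈ h)

lemma PairSettled.cons {h : History} {i : ℕ} (hi : PairSettled h i) (m : Move) :
    PairSettled (m :: h) i :=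
  ⟨hi.1.imp fun _ hb => List.mem_cons_of_mem _ hb,
    hi.2.imp (List.mem_cons_of_mem _)
      fun hb => ⟨List.mem_cons_of_mem _ hb.1, List.mem_cons_of_mem _ hb.2⟩⟩

lemma PairSettled.notMem_unassigned {X : Finset ℕ} {h : History} {i : ℕ} (hi : PairSettled h i) :
    2 * i ∉ unassigned X h ∧ 2 * i + 1 ∉ unassigned X h := by
  simp only [mem_unassigned, not_and]
  obtain ⟨⟨b, hb⟩, h2 | ⟨h2, -⟩⟩ := hi
  exacts [⟨fun _ h => h _ h2, fun _ h => h _ hb⟩, ⟨fun _ h => h _ h2, fun _ h => h _ hb⟩]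

/-- The state of the top pair selects the branch of the recursion: `2 * (n + 1)` false falsifies the
single added literal, both variables true falsify the two added ones. -/
lemma exists_falsified_fibCNF {h : History} (h0 : (0, false) ∈ h) (n : ℕ)
    (hn : ∀ i < n, PairSettled h i) : Unsatisfied (fibCNF n) h := by
  induction n using Nat.twoStepInduction with
  | zero => exact ⟨∅, by simp [fibCNF], by simp⟩
  | one => exact ⟨{(0, true)}, by simp [fibCNF], by simpa using h0⟩
  | more n ih1 ih2 =>
    rcases (hn (n + 1) (by omega)).2 with hx | ⟨hx, hz⟩
    · obtain ⟨C, hC, hf⟩ := ih2 fun i hi => hn i (by omega)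
      refine ⟨insert (2 * (n + 1), true) C, ?_, ?_⟩
      · exact Finset.mem_union_left _ (Finset.mem_image.2 ⟨C, hC, rfl⟩)
      · intro l hl
        rcases Finset.mem_insert.1 hl with rfl | hl
        · exact hx
        · exact hf l hl
    · obtain ⟨C, hC, hf⟩ := ih1 fun i hi => hn i (by omega)
      refine ⟨insert (2 * (n + 1) + 1, false) (insert (2 * (n + 1), false) C), ?_, ?_⟩
      · exact Finset.mem_union_right _ (Finset.mem_image.2 ⟨C, hC, rfl⟩)
      · intro l hl
        simp only [Finset.mem_insert] at hl
        rcases hl with rfl | rfl | hl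
        · exact hz
        · exact hx
        · exact hf l hl

/-- The pair `k` does not occur in the CNF; it gives F an opening move when `k = 0`. -/
lemma fWins_fibCNF (k : ℕ) : FWins (fibCNF k) (Finset.range (2 * (k + 1))) Player.F := by
  set X := Finset.range (2 * (k + 1))
  let Free : History → ℕ → Prop := fun h i => 2 * i ∈ unassigned X h ∧ 2 * i + 1 ∈ unassigned X h
  have freeCons : ∀ {h : History} {i : ℕ} (m : Move), Free h i → m.1 ≠ 2 * i → m.1 ≠ 2 * i + 1 →
      Free (m :: h) i := fun m hF h1 h2 =>
    ⟨mem_unassigned_cons.2 ⟨Ne.symm h1, hF.1⟩, mem_unassigned_cons.2 ⟨Ne.symm h2, hF.2⟩⟩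
  -- Pair `j` is open: its first variable is false and its second, whose value is irrelevant, is
  -- left for T. Lower pairs are settled, higher ones settled or untouched.
  let P : History → Prop := fun h => (0, false) ∈ h ∧ ∃ j ≤ k, (2 * j, false) ∈ h ∧
    2 * j + 1 ∈ unassigned X h ∧ (∀ i < j, PairSettled h i) ∧
    ∀ i ≤ k, j < i → PairSettled h i ∨ Free h i
  refine fWins_of_replies P (0, false) (by simp [X]) ?_ ?_ ?_ ?_
  · refine ⟨by simp, 0, Nat.zero_le k, by simp, ?_, by simp, fun i hi hpos => Or.inr ?_⟩
    · simp only [mem_unassigned_cons, unassigned_nil, X, Finset.mem_range]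
      omega
    · simp only [Free, mem_unassigned_cons, unassigned_nil, X, Finset.mem_range]
      omega
  · rintro h ⟨x, b⟩ ⟨h0, j, hj, hjf, hjz, hlow, hhigh⟩ hm ⟨y, hy⟩
    have hxX := Finset.mem_range.1 (mem_unassigned.1 hm).1
    simp only at hm hxX
    by_cases hxj : x = 2 * j + 1
    · subst hxj
      have hjs : PairSettled ((2 * j + 1, b) :: h) j := ⟨⟨b, by simp⟩, Or.inl (by simp [hjf])⟩
      -- T has closed pair `j`, so F opens the least unsettled pair by making its first variable
      -- false.
      have hex : ∃ i, i ≤ k ∧ ¬ PairSettled ((2 * j + 1, b) :: h) i := by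
        have hyX := Finset.mem_range.1 (mem_unassigned.1 hy).1
        refine ⟨y / 2, by omega, fun hs => ?_⟩
        have hn := hs.notMem_unassigned (X := X)
        rcases Nat.even_or_odd' y with ⟨c, rfl | rfl⟩
        · exact hn.1 (by rwa [show 2 * (2 * c / 2) = 2 * c by omega])
        · exact hn.2 (by rwa [show 2 * ((2 * c + 1) / 2) + 1 = 2 * c + 1 by omega])
      classical
      obtain ⟨hi, hns⟩ := Nat.find_spec hex
      have hmin : ∀ i' < Nat.find hex, i' ≤ k → PairSettled ((2 * j + 1, b) :: h) i' :=
        fun i' hi' hk => by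
          by_contra hcon
          exact Nat.find_min hex hi' ⟨hk, hcon⟩
      generalize Nat.find hex = i at hi hns hmin
      have hji : j < i := by
        rcases lt_trichotomy i j with h1 | rfl | h1
        · exact absurd ((hlow i h1).cons _) hns
        · exact absurd hjs hns
        · exact h1
      have hfree : Free h i := (hhigh i hi hji).resolve_left fun hs => hns (hs.cons _)
      refine ⟨(2 * i, false), mem_unassigned_cons.2 ⟨by simp only; omega, hfree.1⟩,
        by simp [h0], i, hi, by simp, ?_, ?_, ?_⟩
      · simp only [mem_unassigned_cons]
        exact ⟨by omega, by omega, hfree.2⟩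
      · exact fun i' hi' => (hmin i' hi' (by omega)).cons _
      · intro i' hi' hlt
        rcases hhigh i' hi' (by omega) with hs | hF
        · exact Or.inl ((hs.cons _).cons _)
        · exact Or.inr (freeCons _ (freeCons _ hF (by simp only; omega) (by simp only; omega))
            (by simp only; omega) (by simp only; omega))
    · obtain ⟨i, hi, hxi⟩ : ∃ i ≤ k, x = 2 * i ∨ x = 2 * i + 1 := ⟨x / 2, by omega, by omega⟩
      have hns : ¬ PairSettled h i := by
        intro hs
        have hn := hs.notMem_unassigned (X := X)
        rcases hxi with rfl | rfl
        exacts [hn.1 hm, hn.2 hm]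
      have hji : j < i := by
        rcases lt_trichotomy i j with h1 | rfl | h1
        · exact absurd (hlow i h1) hns
        · rcases hxi with rfl | rfl
          · exact absurd hjf ((mem_unassigned.1 hm).2 false)
          · exact absurd rfl hxj
        · exact h1
      have hfree : Free h i := (hhigh i hi hji).resolve_left hns
      -- T has entered an untouched pair, and F settles it: a move on `2 * i` is answered by `2 * i
      -- + 1` true, a move on `2 * i + 1` by `2 * i` false.
      have hkeep : ∀ (y : ℕ) (c : Bool), y = 2 * i ∨ y = 2 * i + 1 →
          PairSettled ((y, c) :: (x, b) :: h) i → P ((y, c) :: (x, b) :: h) := by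
        intro y c hyi hs
        refine ⟨by simp [h0], j, hj, by simp [hjf], ?_, fun i' hi' => ((hlow i' hi').cons _).cons _,
          fun i' hi' hlt => ?_⟩
        · simp only [mem_unassigned_cons]
          exact ⟨by omega, by omega, hjz⟩
        · by_cases hii : i' = i
          · exact Or.inl (hii ▸ hs)
          rcases hhigh i' hi' hlt with hs | hF
          · exact Or.inl ((hs.cons _).cons _)
          · exact Or.inr (freeCons _ (freeCons _ hF (by simp only; omega) (by simp only; omega))
              (by simp only; omega) (by simp only; omega))
      rcases hxi with rfl | rfl
      · refine ⟨(2 * i + 1, true), mem_unassigned_cons.2 ⟨by simp, hfree.2⟩,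
          hkeep _ _ (Or.inr rfl) ⟨⟨true, by simp⟩, ?_⟩⟩
        cases b <;> simp
      · exact ⟨(2 * i, false), mem_unassigned_cons.2 ⟨by simp, hfree.1⟩,
          hkeep _ _ (Or.inl rfl) ⟨⟨b, by simp⟩, Or.inl (by simp)⟩⟩
  -- Vacuous: the open pair still has a free variable after each move of F.
  · rintro h ⟨-, j, -, -, hjz, -⟩ hemp
    simp [hemp] at hjz
  · rintro h ⟨x, b⟩ ⟨h0, j, hj, hjf, hjz, hlow, hhigh⟩ hm hemp
    rw [Finset.eq_empty_iff_forall_notMem] at hemp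
    simp only [mem_unassigned_cons, not_and] at hemp
    have hxj : x = 2 * j + 1 := by
      by_contra hne
      exact hemp _ (Ne.symm hne) hjz
    subst hxj
    refine exists_falsified_fibCNF (by simp [h0]) k fun i hi => ?_
    rcases lt_trichotomy i j with h1 | rfl | h1
    · exact (hlow i h1).cons _
    · exact ⟨⟨b, by simp⟩, Or.inl (by simp [hjf])⟩
    · rcases hhigh i hi.le h1 with hs | hF
      · exact hs.cons _
      · exact absurd hF.1 (hemp _ (by omega))

lemma exists_clauseCounts_le_fib (k : ℕ) :
    ∃ m ∈ clauseCounts k Player.F Player.T, m ≤ Nat.fib (k + 1) := by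
  have h : ∀ C ∈ fibCNF k, ClauseBelow k (2 * (k + 1)) C :=
    fun C hC => (clauseBelow_fibCNF k C hC).mono (by omega)
  exact ⟨_, ⟨fibCNF k, Finset.range (2 * (k + 1)), isInstance_of_clauseBelow h,
    isUniform_of_clauseBelow h, by simp [LastMoveBy], fWins_fibCNF k, rfl⟩, card_fibCNF_le k⟩

/-! ### Assembling the bounds -/

/-- The constructions make `clauseCounts` nonempty, so `M` is attained rather than the default 0 and
the lower bounds apply to it. -/
lemma M_mem_and_le {k n : ℕ} {a b : Player} (h : ∃ m ∈ clauseCounts k a b, m ≤ n) :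
    M k a b ∈ clauseCounts k a b ∧ M k a b ≤ n := by
  obtain ⟨m, hm, hmn⟩ := h
  exact ⟨Nat.sInf_mem ⟨m, hm⟩, (Nat.sInf_le hm).trans hmn⟩

end CNFGame

theorem mainTheorem3 :
    (∀ k : ℕ, Odd k →
      (CNFGame.M k CNFGame.Player.F CNFGame.Player.F : ℝ) = Real.sqrt 2 ^ ((k : ℤ) - 1)) ∧
    (∀ k : ℕ, Even k →
      (3 / 2 : ℝ) * Real.sqrt 2 ^ ((k : ℤ) - 2)
          ≤ (CNFGame.M k CNFGame.Player.F CNFGame.Player.F : ℝ) ∧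
        (CNFGame.M k CNFGame.Player.F CNFGame.Player.F : ℝ) ≤ Real.sqrt 2 ^ k) ∧
    (∀ k : ℕ,
      (3 / 2 : ℝ) ^ ((k : ℤ) - 1) ≤ (CNFGame.M k CNFGame.Player.F CNFGame.Player.T : ℝ) ∧
        CNFGame.M k CNFGame.Player.F CNFGame.Player.T ≤ Nat.fib (k + 1)) := by
  have hsq : Real.sqrt 2 ^ 2 = 2 := Real.sq_sqrt (by norm_num)
  refine ⟨?_, ?_, fun k => ?_⟩
  · rintro k ⟨p, rfl⟩
    obtain ⟨hmem, hle⟩ := CNFGame.M_mem_and_le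
      (CNFGame.exists_clauseCounts_le_pow (B := {(0, true)}) (j := 1) subset_rfl
        ((CNFGame.clauseBelow_empty 0).insert true) p)
    rw [add_comm 1] at hmem hle
    have hge := CNFGame.one_le_mul_halvingWeight hmem
    rw [Nat.add_sub_cancel, CNFGame.halvingWeight_even, one_div, inv_pow, ← div_eq_mul_inv,
      one_le_div (by positivity)] at hge
    have hexp : ((2 * p + 1 : ℕ) : ℤ) - 1 = ((2 * p : ℕ) : ℤ) := by push_cast; ring
    rw [hexp, zpow_natCast, pow_mul, hsq]
    exact le_antisymm (by exact_mod_cast hle) hge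
  · intro k hk
    obtain ⟨p, rfl⟩ := even_iff_exists_two_mul.1 hk
    obtain ⟨hmem, hle⟩ := CNFGame.M_mem_and_le
      (CNFGame.exists_clauseCounts_le_pow (Finset.empty_subset _) (CNFGame.clauseBelow_empty 1) p)
    rw [zero_add] at hmem hle
    have hge := CNFGame.one_le_mul_halvingWeight hmem
    refine ⟨?_, by rw [pow_mul, hsq]; exact_mod_cast hle⟩
    cases p with
    -- For `k = 0` the claimed lower bound is 3/4, while at least one clause is needed.
    | zero =>
      have h1 : (1 : ℝ) ≤ CNFGame.M (2 * 0) CNFGame.Player.F CNFGame.Player.F := by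
        simpa [CNFGame.halvingWeight] using hge
      have hexp : ((2 * 0 : ℕ) : ℤ) - 2 = -((2 : ℕ) : ℤ) := by norm_num
      rw [hexp, zpow_neg, zpow_natCast, hsq]
      linarith
    | succ p =>
      rw [show 2 * (p + 1) - 1 = 2 * p + 1 by omega, CNFGame.halvingWeight_odd, one_div, inv_pow]
        at hge
      have hexp : ((2 * (p + 1) : ℕ) : ℤ) - 2 = ((2 * p : ℕ) : ℤ) := by push_cast; ring
      rw [hexp, zpow_natCast, pow_mul, hsq]
      have hpos : (0 : ℝ) < 2 ^ p := by positivity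
      field_simp at hge
      linarith
  · obtain ⟨hmem, hle⟩ := CNFGame.M_mem_and_le (CNFGame.exists_clauseCounts_le_fib k)
    refine ⟨?_, hle⟩
    have hge := CNFGame.one_le_mul_two_thirds_pow hmem
    cases k with
    -- Here the exponent is -1 and the bound 2/3.
    | zero =>
      have h1 : (1 : ℝ) ≤ CNFGame.M 0 CNFGame.Player.F CNFGame.Player.T := by simpa using hge
      norm_num
      linarith
    | succ k =>
      have hexp : ((k + 1 : ℕ) : ℤ) - 1 = (k : ℤ) := by push_cast; ring
      rw [hexp, zpow_natCast]
      rw [Nat.add_sub_cancel, show (2 / 3 : ℝ) = (3 / 2)⁻¹ by norm_num, inv_pow,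
        ← div_eq_mul_inv, one_le_div (by positivity)] at hge
      exact hge
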